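/- **Setting.** A system of finitely many asynchronous deterministic threads communicates through shared memory with atomic reads and compare-and-swap (CAS), under an arbitrary scheduler. Addresses are totally ordered. Each addressable word holds either a regular value or a pointer to a *word descriptor*. An *MCAS descriptor* $d$ consists of a status field $d.\mathit{status}\in\{\mathrm{ACTIVE},\mathrm{SUCCESSFUL},\mathrm{FAILED}\}$ and an array of $N_d\ge 0$ word descriptors, each containing an address, an expected value $\mathit{old}$ and a new value $\mathit{new}$ (both regular values) and having $d$ as its parent. The array is sorted by address; $N_d$ may differ between descriptors. Initially all words hold regular values, all descriptors are ACTIVE and no operation is ongoing. Memory is never reclaimed, and words and status fields are modified only by the CAS instructions below. **Algorithm.** The operations $\mathrm{read}(a)$ and $\mathrm{MCAS}(d)$ are implemented as follows. - $\mathrm{readInternal}(a,\mathit{self})$: (1) read $c:=\ast a$. If $c$ is a regular value, return $\langle c,c\rangle$. Otherwise $c$ points to a word descriptor with some parent $p$. (2) If $p\neq\mathit{self}$ and $p.\mathit{status}=\mathrm{ACTIVE}$, call $\mathrm{MCAS}(p)$ (helping) and, when it has returned, go back to (1). (3) Otherwise return $\langle c,c.\mathit{new}\rangle$ if $p.\mathit{status}=\mathrm{SUCCESSFUL}$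 and $\langle c,c.\mathit{old}\rangle$ if not (the status is read anew). - $\mathrm{read}(a)$: let $\langle c,v\rangle:=\mathrm{readInternal}(a,\mathrm{NULL})$ and return $v$. - $\mathrm{MCAS}(d)$: set $\mathit{success}:=\mathrm{true}$. For each word descriptor $w$ of $d$ in order: (a) $\langle c,v\rangle:=\mathrm{readInternal}(w.\mathit{address},d)$; (b) if $c$ is the pointer to $w$, continue with the next word descriptor; (c) if $v\ne w.\mathit{old}$, set $\mathit{success}:=\mathrm{false}$ and leave the loop; (d) if $d.\mathit{status}\neq\mathrm{ACTIVE}$, leave the loop; (e) execute $\mathrm{CAS}(w.\mathit{address},c,\text{pointer to }w)$ and, if it fails, go back to (a) for the same $w$. After the loop execute $\mathrm{CAS}(d.\mathit{status},\mathrm{ACTIVE},\mathit{success}\ ?\ \mathrm{SUCCESSFUL}:\mathrm{FAILED})$, and return whether $d.\mathit{status}=\mathrm{SUCCESSFUL}$. A step of a thread is either the invocation of an operation (if the thread has no ongoing operation), where each invocation of MCAS uses a descriptor for which no MCAS has been invoked before, or the execution of the next shared-memory access of its ongoing operation (together with the local computation that follows it). An operation *returns* when the call invoked by its thread returns; the return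 of a recursive helping call is not the return of an operation. **Statement.** The implementation is lock-free: for every number $n$ of threads and every execution of the $n$ threads from the initial state in which some thread takes infinitely many steps, after every time $t_0$ some operation (of some thread) returns at some time $t\ge t_0$. -/

import Mathlib

namespace MCAS

/-- The status word of an MCAS operation descriptor. -/
inductive Status where
  | active
  | successful
  | failed
  deriving DecidableEq

/-- One target of an MCAS operation: address, expected value, new value. The pointer to the parent
descriptor is part of the address of a word descriptor, see `WordPtr`. -/
structure WordDescriptor (Addr Val : Type*) where
  address : Addr
  old : Val
  new : Val

/-- The immutable part of an MCAS operation descriptor: the array of its word descriptors, sorted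
by address. The mutable `status` field lives in shared memory, see `Shared`. -/
structure MCASDescriptor (Addr Val : Type*) [LinearOrder Addr] where
  N : ℕ
  words : Fin N → WordDescriptor Addr Val
  sorted : Monotone fun i => (words i).address

section Algorithm

variable {Addr Val D : Type*} [LinearOrder Addr] (desc : D → MCASDescriptor Addr Val)

/-- Pointers to word descriptors: `⟨d, i⟩` is the address of the `i`-th word descriptor of the MCAS
descriptor `d`, and `d` is its parent. -/
abbrev WordPtr := (d : D) × Fin (desc d).N

/-- Contents of a word of shared memory: a regular value or a pointer to a word descriptor. -/
inductive Word where
  | value (v : Val)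
  | ptr (p : WordPtr desc)
  deriving DecidableEq

/-- Shared memory: the words at all addresses and the status fields of all descriptors. -/
structure Shared where
  mem : Addr → Word desc
  status : D → Status

/-- Program locations of `readInternal`. Each one is an atomic access to shared memory. -/
inductive ReadPC where
  /-- `val = *addr` -/
  | load
  /-- `parent->status == ACTIVE`, where `val` is the pointer `p` and its parent is not `self` -/
  | check (p : WordPtr desc)
  /-- `return parent->status == SUCCESSFUL ? <val, val->new> : <val, val->old>` -/
  | result (p : WordPtr desc)

/-- Program locations of `MCAS(d)`. Each one is an atomic access to shared memory. -/
inductive MCASPC (d : D) where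
  /-- inside the call of `readInternal` for the `i`-th word -/
  | reading (i : Fin (desc d).N) (pc : ReadPC desc)
  /-- `if (desc->status != ACTIVE) break` -/
  | statusCheck (i : Fin (desc d).N) (content : Word desc)
  /-- `if (!CAS(wordDesc.address, content, &wordDesc)) goto retry_word` -/
  | acquire (i : Fin (desc d).N) (content : Word desc)
  /-- `CAS(&desc.status, ACTIVE, success ? SUCCESSFUL : FAILED)` -/
  | finalize (success : Bool)
  /-- `return (desc.status == SUCCESSFUL)` -/
  | ret

/-- An entry of the call stack of a thread: a call of `read` or a call of `MCAS`. -/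
inductive Frame where
  | read (addr : Addr) (pc : ReadPC desc)
  | mcas (d : D) (pc : MCASPC desc d)

/-- The outcome of one step of `readInternal`. -/
inductive ReadOutcome where
  | goto (pc : ReadPC desc)
  /-- call `MCAS(d)`, then `goto retry_read` -/
  | help (d : D)
  | done (content : Word desc) (value : Val)

/-- Return values of operations: a value for `read`, a success indication for `MCAS`. -/
inductive Result (Val : Type*) where
  | value (v : Val)
  | success (b : Bool)

/-- What one step does to the call stack. -/
inductive Action where
  /-- replace the topmost entry -/
  | goto (f : Frame desc)
  /-- replace the topmost entry by `f` and call `MCAS(d)` -/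
  | call (f : Frame desc) (d : D)
  /-- return from the topmost call -/
  | ret (r : Result Val)

variable {desc}

/-- The program location of `MCAS(d)` at the beginning of the loop body for word number `k`, or
after the loop if there is no such word. -/
def nextWord (d : D) (k : ℕ) : MCASPC desc d :=
  if h : k < (desc d).N then .reading ⟨k, h⟩ .load else .finalize true

variable [DecidableEq D] [DecidableEq Val]

/-- One step of `readInternal(addr, self)`, where `none` stands for `NULL`. -/
def readInternalStep (s : Shared desc) (addr : Addr) (self : Option D) :
    ReadPC desc → ReadOutcome desc
  | .load =>
    match s.mem addr with
    | .value v => .done (.value v) v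
    | .ptr p => if some p.1 = self then .goto (.result p) else .goto (.check p)
  | .check p => if s.status p.1 = .active then .help p.1 else .goto (.result p)
  | .result p =>
    if s.status p.1 = .successful then .done (.ptr p) ((desc p.1).words p.2).new
    else .done (.ptr p) ((desc p.1).words p.2).old

/-- One step of `MCAS(d)`. -/
def mcasStep (s : Shared desc) (d : D) : MCASPC desc d → Shared desc × Action desc
  | .reading i pc =>
    match readInternalStep s ((desc d).words i).address (some d) pc with
    | .goto pc' => (s, .goto (.mcas d (.reading i pc')))
    | .help e => (s, .call (.mcas d (.reading i .load)) e)
    | .done content value =>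
      if content = .ptr ⟨d, i⟩ then (s, .goto (.mcas d (nextWord d (i + 1))))
      else if value ≠ ((desc d).words i).old then (s, .goto (.mcas d (.finalize false)))
      else (s, .goto (.mcas d (.statusCheck i content)))
  | .statusCheck i content =>
    if s.status d ≠ .active then (s, .goto (.mcas d (.finalize true)))
    else (s, .goto (.mcas d (.acquire i content)))
  | .acquire i content =>
    if s.mem ((desc d).words i).address = content then
      ({ s with mem := Function.update s.mem ((desc d).words i).address (.ptr ⟨d, i⟩) },
        .goto (.mcas d (nextWord d (i + 1))))
    else (s, .goto (.mcas d (.reading i .load)))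
  | .finalize success =>
    if s.status d = .active then
      ({ s with status := Function.update s.status d (if success then .successful else .failed) },
        .goto (.mcas d .ret))
    else (s, .goto (.mcas d .ret))
  | .ret => (s, .ret (.success (decide (s.status d = .successful))))

/-- One step of the topmost call of a thread. -/
def frameStep (s : Shared desc) : Frame desc → Shared desc × Action desc
  | .read addr pc =>
    match readInternalStep s addr none pc with
    | .goto pc' => (s, .goto (.read addr pc'))
    | .help e => (s, .call (.read addr .load) e)
    | .done _ value => (s, .ret (.value value))
  | .mcas d pc => mcasStep s d pc

variable (desc) in
/-- A configuration of a system of `n` threads: the shared memory, the call stack of each thread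
(topmost call first, empty if the thread has no ongoing operation) and the set of descriptors for
which an MCAS operation has been invoked. -/
structure Config (n : ℕ) where
  shared : Shared desc
  stack : Fin n → List (Frame desc)
  used : Set D

/-- What a step of a thread looks like from the outside. -/
inductive Event (Addr Val D : Type*) where
  | invokeRead (addr : Addr)
  | invokeMCAS (d : D)
  | internal
  | response (r : Result Val)

/-- `Step c T e c'`: in configuration `c`, thread `T` can take a step, leading to `c'`. A thread
without an ongoing operation can invoke a `read` or an `MCAS` with a fresh descriptor; a thread with
an ongoing operation can execute its next instruction. -/
inductive Step {n : ℕ} : Config desc n → Fin n → Event Addr Val D → Config desc n → Prop where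
  | invokeRead (c : Config desc n) (T : Fin n) (addr : Addr) :
      c.stack T = [] →
      Step c T (.invokeRead addr)
        { c with stack := Function.update c.stack T [.read addr .load] }
  | invokeMCAS (c : Config desc n) (T : Fin n) (d : D) :
      c.stack T = [] → d ∉ c.used →
      Step c T (.invokeMCAS d)
        { c with
          stack := Function.update c.stack T [.mcas d (nextWord d 0)]
          used := insert d c.used }
  | goto (c : Config desc n) (T : Fin n) (f f' : Frame desc) (fs : List (Frame desc))
      (s' : Shared desc) :
      c.stack T = f :: fs → frameStep c.shared f = (s', .goto f') →
      Step c T .internal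
        { c with shared := s', stack := Function.update c.stack T (f' :: fs) }
  | call (c : Config desc n) (T : Fin n) (f f' : Frame desc) (fs : List (Frame desc))
      (s' : Shared desc) (d : D) :
      c.stack T = f :: fs → frameStep c.shared f = (s', .call f' d) →
      Step c T .internal
        { c with
          shared := s'
          stack := Function.update c.stack T (.mcas d (nextWord d 0) :: f' :: fs) }
  | innerReturn (c : Config desc n) (T : Fin n) (f g : Frame desc) (fs : List (Frame desc))
      (s' : Shared desc) (r : Result Val) :
      c.stack T = f :: g :: fs → frameStep c.shared f = (s', .ret r) →
      Step c T .internal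
        { c with shared := s', stack := Function.update c.stack T (g :: fs) }
  | response (c : Config desc n) (T : Fin n) (f : Frame desc) (s' : Shared desc)
      (r : Result Val) :
      c.stack T = [f] → frameStep c.shared f = (s', .ret r) →
      Step c T (.response r)
        { c with shared := s', stack := Function.update c.stack T [] }

/-- Initially every address holds a regular value, every descriptor is active, and no operation has
been invoked. -/
def Config.IsInitial {n : ℕ} (c : Config desc n) : Prop :=
  (∀ a, ∃ v, c.shared.mem a = .value v) ∧ (∀ d, c.shared.status d = .active) ∧
    (∀ T, c.stack T = []) ∧ c.used = ∅

variable (desc) in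
/-- An infinite execution of `n` threads under an arbitrary scheduler: at time `t`, thread
`thread t` takes the step from `config t` to `config (t + 1)`. -/
structure Execution (n : ℕ) where
  config : ℕ → Config desc n
  thread : ℕ → Fin n
  event : ℕ → Event Addr Val D
  initial : (config 0).IsInitial
  step : ∀ t, Step (config t) (thread t) (event t) (config (t + 1))

variable (desc) in
/-- Lock-freedom for `n` threads: whenever some thread keeps taking steps, then from any time on
some operation (of some thread) eventually returns. -/
def LockFree (n : ℕ) : Prop :=
  ∀ E : Execution desc n, (∃ T : Fin n, ∃ᶠ t in Filter.atTop, E.thread t = T) →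
    ∀ t₀ : ℕ, ∃ t ≥ t₀, ∃ r : Result Val, E.event t = .response r

end Algorithm

end MCAS

/-!
Every step other than a response strictly decreases a measure of configurations with values in a
lexicographic product of six copies of `ℕ` (`Step.progress_lt`), so an execution without responses
from some time on would be an infinite descent. The components of `progress`, most significant
first, are

* the number of threads without an ongoing operation (decreased by invocations);
* the number of invoked descriptors that are still active (decreased by the CAS on a status);
* the sum over all threads of `|used| - activeDepth`, where `activeDepth` is the number of
  consecutive topmost calls of the thread that work for active descriptors (decreased by helping);
* the total number of calls in progress (decreased by the return of a helping call);
* the total number of words which the calls in progress have still to acquire (decreased by a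
  successful CAS on a word);
* the sum of the ranks of the program locations, where a location holding an outdated content of
  a word counts extra (decreased by every other step, in particular by a failing CAS, whose retry
  discards the outdated content).

A failing CAS is not charged to a particular successful one: success of any thread decreases the
fifth component, and then the sixth one may grow.

The third component decreases because `activeDepth` never exceeds the number of invoked descriptors
(`activeDepth_le`), which is where the order of the addresses enters. The words at the addresses
that an active descriptor has acquired keep pointing to it until it is decided, and they are
acquired in order (`Shared.Valid`). If a call for `d` helps `e`, then `e` owns the address `a` at
which `d` waits, hence also all smaller addresses among its own. So a call for `e` can only wait at
an address above `a`, and the addresses along a chain of active calls increase towards the top of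
the stack. Hence no active descriptor occurs twice in such a chain.
-/

namespace MCAS

section Proof

variable {Addr Val D : Type*} [LinearOrder Addr] {desc : D → MCASDescriptor Addr Val}

/-! ### Ownership of addresses -/

/-- The word at address `a` holds a pointer to a word descriptor with parent `d`. -/
def Shared.Owns (s : Shared desc) (d : D) (a : Addr) : Prop :=
  ∃ i, s.mem a = .ptr ⟨d, i⟩

/-- If `d` is active, it owns the addresses of its first `k` words. -/
def Shared.OwnsBelow (s : Shared desc) (d : D) (k : ℕ) : Prop :=
  s.status d = .active → ∀ j : Fin (desc d).N, (j : ℕ) < k → s.Owns d ((desc d).words j).address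

/-- Invariant of the shared memory, where `used` is the set of invoked descriptors: pointers are
stored at the address they are meant for, and an active descriptor acquires its words in order. -/
structure Shared.Valid (s : Shared desc) (used : Set D) : Prop where
  mem_used : ∀ a p, s.mem a = .ptr p → p.1 ∈ used
  address_eq : ∀ a p, s.mem a = .ptr p → ((desc p.1).words p.2).address = a
  ownsBelow : ∀ a p, s.mem a = .ptr p → s.OwnsBelow p.1 p.2

/-- `s'` may arise from `s`: descriptors are not reactivated, and descriptors that are still active
keep the addresses they own. -/
structure Shared.Evolves (s s' : Shared desc) : Prop where
  active : ∀ d, s'.status d = .active → s.status d = .active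
  owns : ∀ d a, s'.status d = .active → s.Owns d a → s'.Owns d a

theorem Shared.Evolves.refl (s : Shared desc) : s.Evolves s :=
  ⟨fun _ h => h, fun _ _ _ h => h⟩

theorem Shared.OwnsBelow.zero (s : Shared desc) (d : D) : s.OwnsBelow d 0 :=
  fun _ _ h => absurd h (Nat.not_lt_zero _)

theorem Shared.OwnsBelow.succ {s : Shared desc} {d : D} {i : Fin (desc d).N}
    (h : s.OwnsBelow d i) (hi : s.status d = .active → s.Owns d ((desc d).words i).address) :
    s.OwnsBelow d (i + 1) := by
  intro hd j hj
  rcases Nat.lt_succ_iff_lt_or_eq.1 hj with hj | hj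
  · exact h hd j hj
  · rw [Fin.ext hj]
    exact hi hd

theorem Shared.OwnsBelow.evolves {s s' : Shared desc} (hs : s.Evolves s') {d : D} {k : ℕ}
    (h : s.OwnsBelow d k) : s'.OwnsBelow d k :=
  fun hd j hj => hs.owns _ _ hd (h (hs.active _ hd) j hj)

/-- An active descriptor that owns an address owns all smaller addresses among its own. -/
theorem Shared.Valid.owns_of_le {s : Shared desc} {used : Set D} (hs : s.Valid used) {d : D}
    (hd : s.status d = .active) {b : Addr} (hb : s.Owns d b) (i : Fin (desc d).N)
    (hi : ((desc d).words i).address ≤ b) : s.Owns d ((desc d).words i).address := by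
  obtain ⟨k, hk⟩ := hb
  have hkb := hs.address_eq b _ hk
  rcases lt_or_ge i k with hik | hik
  · exact hs.ownsBelow b _ hk hd i hik
  · have : ((desc d).words i).address = b := le_antisymm hi (hkb ▸ (desc d).sorted hik)
    exact ⟨k, this ▸ hk⟩

theorem Shared.Owns.unique {s : Shared desc} {d e : D} {a : Addr} (hd : s.Owns d a)
    (he : s.Owns e a) : d = e := by
  obtain ⟨i, hi⟩ := hd
  obtain ⟨j, hj⟩ := he
  rw [hi] at hj
  injection hj with hj
  exact congrArg Sigma.fst hj

/-! ### Invariants of program locations -/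

/-- What a call of `readInternal` with argument `self` at address `addr` knows about a pointer it
may return: replacing it does not take the address from another active descriptor. -/
def Shared.Settled (s : Shared desc) (addr : Addr) (self : Option D) (p : WordPtr desc) : Prop :=
  (some p.1 = self ∨ s.status p.1 ≠ .active) ∧ (s.status p.1 = .active → s.Owns p.1 addr)

/-- Invariant of the program locations of `readInternal(addr, self)`. -/
def ReadPC.Valid (s : Shared desc) (addr : Addr) (self : Option D) : ReadPC desc → Prop
  | .load => True
  | .check p => some p.1 ≠ self ∧ (s.status p.1 = .active → s.Owns p.1 addr)
  | .result p => s.Settled addr self p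

/-- Invariant of the program locations of `MCAS(d)`. -/
def MCASPC.Valid (s : Shared desc) (d : D) : MCASPC desc d → Prop
  | .reading i pc => s.OwnsBelow d i ∧ pc.Valid s ((desc d).words i).address (some d)
  | .statusCheck i c | .acquire i c =>
    s.OwnsBelow d i ∧ ∀ p, c = .ptr p → s.Settled ((desc d).words i).address (some d) p
  | .finalize _ => True
  | .ret => s.status d ≠ .active

/-- Invariant of the program locations of a call. -/
def Frame.Valid (s : Shared desc) : Frame desc → Prop
  | .read addr pc => pc.Valid s addr none
  | .mcas d pc => pc.Valid s d

/-- The descriptor on which a call of `MCAS` works. -/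
def Frame.target : Frame desc → Option D
  | .read _ _ => none
  | .mcas d _ => some d

/-- The call waits for a helping call of `MCAS(e)`. A waiting call of `MCAS(d)` waits at an address
that `e` owns as long as it is active. -/
def Frame.WaitsFor (s : Shared desc) (e : D) : Frame desc → Prop
  | .read _ _ => True
  | .mcas d (.reading i .load) =>
    e ≠ d ∧ (s.status e = .active → s.Owns e ((desc d).words i).address)
  | .mcas _ _ => False

/-- Relation between a call `f` and the call `g` immediately below it on a stack. -/
def Frame.CalledBy (s : Shared desc) (f g : Frame desc) : Prop :=
  ∃ e, f.target = some e ∧ g.WaitsFor s e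

theorem Shared.Settled.evolves {s s' : Shared desc} (hs : s.Evolves s') {addr : Addr}
    {self : Option D} {p : WordPtr desc} (h : s.Settled addr self p) : s'.Settled addr self p :=
  ⟨h.1.imp_right fun h h' => h (hs.active _ h'),
    fun h' => hs.owns _ _ h' (h.2 (hs.active _ h'))⟩

theorem ReadPC.Valid.evolves {s s' : Shared desc} (hs : s.Evolves s') {addr : Addr}
    {self : Option D} {pc : ReadPC desc} (h : pc.Valid s addr self) : pc.Valid s' addr self := by
  cases pc with
  | load => trivial
  | check p => exact ⟨h.1, fun h' => hs.owns _ _ h' (h.2 (hs.active _ h'))⟩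
  | result p => exact Shared.Settled.evolves hs h

theorem Frame.Valid.evolves {s s' : Shared desc} (hs : s.Evolves s') {f : Frame desc}
    (h : f.Valid s) : f.Valid s' := by
  match f, h with
  | .read _ _, h => exact ReadPC.Valid.evolves hs h
  | .mcas _ (.reading _ _), h => exact ⟨h.1.evolves hs, h.2.evolves hs⟩
  | .mcas _ (.statusCheck _ _), h => exact ⟨h.1.evolves hs, fun p hp => (h.2 p hp).evolves hs⟩
  | .mcas _ (.acquire _ _), h => exact ⟨h.1.evolves hs, fun p hp => (h.2 p hp).evolves hs⟩
  | .mcas _ (.finalize _), _ => trivial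
  | .mcas _ .ret, h => exact fun h' => h (hs.active _ h')

theorem Frame.CalledBy.evolves {s s' : Shared desc} (hs : s.Evolves s') {f g : Frame desc}
    (h : f.CalledBy s g) : f.CalledBy s' g := by
  obtain ⟨e, he, hg⟩ := h
  refine ⟨e, he, ?_⟩
  match g, hg with
  | .read _ _, _ => trivial
  | .mcas d (.reading i .load), hg =>
    exact ⟨hg.1, fun h' => hs.owns _ _ h' (hg.2 (hs.active _ h'))⟩

theorem Frame.CalledBy.congr_left {s : Shared desc} {f f' g : Frame desc}
    (hf : f'.target = f.target) (h : f.CalledBy s g) : f'.CalledBy s g := by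
  obtain ⟨e, he, hg⟩ := h
  exact ⟨e, hf.trans he, hg⟩

theorem valid_nextWord {s : Shared desc} {d : D} {k : ℕ} (h : s.OwnsBelow d k) :
    (nextWord d k).Valid s d := by
  unfold nextWord
  split
  · exact ⟨h, trivial⟩
  · trivial

/-! ### Ranks of program locations -/

/-- The number of words which a call has still to acquire, including the current one. -/
def Frame.remaining : Frame desc → ℕ
  | .mcas d (.reading i _) | .mcas d (.statusCheck i _) | .mcas d (.acquire i _) =>
    (desc d).N - i
  | _ => 0

theorem remaining_nextWord (d : D) (k : ℕ) :
    (Frame.mcas d (nextWord (desc := desc) d k)).remaining = (desc d).N - k := by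
  unfold nextWord
  split
  · rfl
  · simp only [Frame.remaining]
    omega

open Classical in
/-- Extra rank of a location that holds the content `c` of the word at `addr`: as discarding an
outdated content leads back to `load`, it has to exceed the difference between the ranks of `load`
and of an acquisition with the current content. -/
noncomputable def Shared.staleness (s : Shared desc) (addr : Addr) (c : Word desc) : ℕ :=
  if s.mem addr = c then 0 else 6

/-- Rank of the program locations of `readInternal`. -/
noncomputable def ReadPC.rank (s : Shared desc) (addr : Addr) : ReadPC desc → ℕ
  | .load => 6
  | .check p => 5 + s.staleness addr (.ptr p)
  | .result p => 4 + s.staleness addr (.ptr p)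

/-- Rank of the program locations of a call. It decreases with every step that neither advances the
call to another word nor changes the memory. -/
noncomputable def Frame.rank (s : Shared desc) : Frame desc → ℕ
  | .read addr pc => pc.rank s addr
  | .mcas d (.reading i pc) => pc.rank s ((desc d).words i).address
  | .mcas d (.statusCheck i c) => 3 + s.staleness ((desc d).words i).address c
  | .mcas d (.acquire i c) => 2 + s.staleness ((desc d).words i).address c
  | .mcas _ (.finalize _) => 1
  | .mcas _ .ret => 0

/-! ### Single steps of a call -/

/-- A successful acquisition takes the address from no other active descriptor. -/
theorem evolves_acquire {s : Shared desc} {d : D} {i : Fin (desc d).N} {c : Word desc}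
    (hc : ∀ p, c = .ptr p → s.Settled ((desc d).words i).address (some d) p)
    (hm : s.mem ((desc d).words i).address = c) :
    s.Evolves { s with mem := Function.update s.mem ((desc d).words i).address (.ptr ⟨d, i⟩) } := by
  refine ⟨fun _ h => h, fun e a he ⟨j, hj⟩ => ?_⟩
  rcases eq_or_ne a ((desc d).words i).address with rfl | ha
  · rcases (hc ⟨e, j⟩ (hm ▸ hj)).1 with h | h
    · cases h
      exact ⟨i, Function.update_self ..⟩
    · exact absurd he h
  · exact ⟨j, (Function.update_of_ne ha ..).trans hj⟩

theorem valid_acquire {s : Shared desc} {used : Set D} (hs : s.Valid used) {d : D}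
    (hd : d ∈ used) {i : Fin (desc d).N} (hi : s.OwnsBelow d i)
    (he : s.Evolves
      { s with mem := Function.update s.mem ((desc d).words i).address (.ptr ⟨d, i⟩) }) :
    Shared.Valid { s with mem := Function.update s.mem ((desc d).words i).address (.ptr ⟨d, i⟩) }
      used := by
  -- Each pointer in the new memory is either the new one or an old one in its place.
  have key : ∀ a p,
      Function.update s.mem ((desc d).words i).address (.ptr ⟨d, i⟩) a = .ptr p →
      (a = ((desc d).words i).address ∧ p = ⟨d, i⟩) ∨ s.mem a = .ptr p := by
    intro a p h
    rcases eq_or_ne a ((desc d).words i).address with rfl | ha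
    · rw [Function.update_self] at h
      cases h
      exact .inl ⟨rfl, rfl⟩
    · rw [Function.update_of_ne ha] at h
      exact .inr h
  refine ⟨fun a p h => ?_, fun a p h => ?_, fun a p h => ?_⟩ <;>
    rcases key a p h with ⟨rfl, rfl⟩ | h
  · exact hd
  · exact hs.mem_used a p h
  · rfl
  · exact hs.address_eq a p h
  · exact hi.evolves he
  · exact (hs.ownsBelow a p h).evolves he

section Steps

variable [DecidableEq D]

theorem readInternalStep_goto {s : Shared desc} {addr : Addr} {self : Option D}
    {pc pc' : ReadPC desc} (h : readInternalStep s addr self pc = .goto pc')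
    (hpc : pc.Valid s addr self) : pc'.Valid s addr self ∧ pc'.rank s addr < pc.rank s addr := by
  cases pc with
  | load =>
    simp only [readInternalStep] at h
    split at h
    · cases h
    · next p hp =>
      split at h <;> cases h
      · next hs => exact ⟨⟨.inl hs, fun _ => ⟨p.2, hp⟩⟩, by simp [ReadPC.rank, Shared.staleness, hp]⟩
      · next hs => exact ⟨⟨hs, fun _ => ⟨p.2, hp⟩⟩, by simp [ReadPC.rank, Shared.staleness, hp]⟩
  | check p =>
    simp only [readInternalStep] at h
    split at h <;> cases h
    next hs => exact ⟨⟨.inr hs, hpc.2⟩, by simp [ReadPC.rank]⟩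
  | result p =>
    simp only [readInternalStep] at h
    split at h <;> cases h

theorem readInternalStep_help {s : Shared desc} {addr : Addr} {self : Option D}
    {pc : ReadPC desc} {e : D} (h : readInternalStep s addr self pc = .help e)
    (hpc : pc.Valid s addr self) : some e ≠ self ∧ s.status e = .active ∧ s.Owns e addr := by
  cases pc with
  | load =>
    simp only [readInternalStep] at h
    split at h
    · cases h
    · split at h <;> cases h
  | check p =>
    simp only [readInternalStep] at h
    split at h <;> cases h
    next hs => exact ⟨hpc.1, hs, hpc.2 hs⟩
  | result p =>
    simp only [readInternalStep] at h
    split at h <;> cases h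

theorem readInternalStep_done {s : Shared desc} {addr : Addr} {self : Option D}
    {pc : ReadPC desc} {c : Word desc} {v : Val}
    (h : readInternalStep s addr self pc = .done c v) (hpc : pc.Valid s addr self) :
    (∀ p, c = .ptr p → s.Settled addr self p) ∧ 3 + s.staleness addr c < pc.rank s addr := by
  cases pc with
  | load =>
    simp only [readInternalStep] at h
    split at h
    · next hv =>
      cases h
      exact ⟨fun p hp => (nomatch hp), by simp [ReadPC.rank, Shared.staleness, hv]⟩
    · split at h <;> cases h
  | check p =>
    simp only [readInternalStep] at h
    split at h <;> cases h
  | result p =>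
    have hc : c = .ptr p := by
      simp only [readInternalStep] at h
      split at h <;> cases h <;> rfl
    subst hc
    refine ⟨fun q hq => ?_, by simp [ReadPC.rank]⟩
    cases hq
    exact hpc

/-- Consequences of a step which stays in the topmost call `f` and turns it into `f'`. -/
structure GotoSpec (used : Set D) (s s' : Shared desc) (f f' : Frame desc) : Prop where
  evolves : s.Evolves s'
  shared : s'.Valid used
  frame : f'.Valid s'
  target : f'.target = f.target
  /-- The step decides the status of the descriptor, acquires or skips words, or makes progress
  within the treatment of the current word. -/
  progress : (∃ d ∈ used, s.status d = .active ∧ s'.status d ≠ .active) ∨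
    s'.status = s.status ∧
      (f'.remaining < f.remaining ∨ s' = s ∧ f'.remaining = f.remaining ∧ f'.rank s < f.rank s)

variable [DecidableEq Val]

theorem frameStep_goto {s s' : Shared desc} {used : Set D} {f f' : Frame desc}
    (h : frameStep s f = (s', .goto f')) (hs : s.Valid used) (hf : f.Valid s)
    (hu : ∀ d, f.target = some d → d ∈ used) : GotoSpec used s s' f f' := by
  match f, hf, hu with
  | .read addr pc, hf, _ =>
    simp only [frameStep] at h
    split at h <;> cases h
    next hr =>
    obtain ⟨h₁, h₂⟩ := readInternalStep_goto hr hf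
    exact ⟨.refl s, hs, h₁, rfl, .inr ⟨rfl, .inr ⟨rfl, rfl, h₂⟩⟩⟩
  | .mcas d (.reading i pc), hf, _ =>
    simp only [frameStep, mcasStep] at h
    have hi := i.2
    split at h
    · next hr =>
      cases h
      obtain ⟨h₁, h₂⟩ := readInternalStep_goto hr hf.2
      exact ⟨.refl s, hs, ⟨hf.1, h₁⟩, rfl, .inr ⟨rfl, .inr ⟨rfl, rfl, h₂⟩⟩⟩
    · cases h
    · next c v hr =>
      obtain ⟨h₁, h₂⟩ := readInternalStep_done hr hf.2
      split at h
      · next hc =>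
        cases h
        refine ⟨.refl s, hs, valid_nextWord (hf.1.succ (h₁ _ hc).2), rfl, .inr ⟨rfl, .inl ?_⟩⟩
        rw [remaining_nextWord]
        simp only [Frame.remaining]
        omega
      · split at h <;> cases h
        · refine ⟨.refl s, hs, trivial, rfl, .inr ⟨rfl, .inl ?_⟩⟩
          simp only [Frame.remaining]
          omega
        · exact ⟨.refl s, hs, ⟨hf.1, h₁⟩, rfl, .inr ⟨rfl, .inr ⟨rfl, rfl, h₂⟩⟩⟩
  | .mcas d (.statusCheck i c), hf, _ =>
    simp only [frameStep, mcasStep] at h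
    have hi := i.2
    split at h <;> cases h
    · refine ⟨.refl s, hs, trivial, rfl, .inr ⟨rfl, .inl ?_⟩⟩
      simp only [Frame.remaining]
      omega
    · exact ⟨.refl s, hs, hf, rfl, .inr ⟨rfl, .inr ⟨rfl, rfl, by simp [Frame.rank]⟩⟩⟩
  | .mcas d (.acquire i c), hf, hu =>
    simp only [frameStep, mcasStep] at h
    have hi := i.2
    split at h <;> cases h
    · next hc =>
      have he := evolves_acquire hf.2 hc
      refine ⟨he, valid_acquire hs (hu d rfl) hf.1 he, valid_nextWord ((hf.1.evolves he).succ
        fun _ => ⟨i, Function.update_self ..⟩), rfl, .inr ⟨rfl, .inl ?_⟩⟩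
      rw [remaining_nextWord]
      simp only [Frame.remaining]
      omega
    · next hc =>
      exact ⟨.refl s, hs, ⟨hf.1, trivial⟩, rfl,
        .inr ⟨rfl, .inr ⟨rfl, rfl, by simp [Frame.rank, ReadPC.rank, Shared.staleness, hc]⟩⟩⟩
  | .mcas d (.finalize b), hf, hu =>
    simp only [frameStep, mcasStep] at h
    split at h <;> cases h
    · next hd =>
      have hne : (if b then Status.successful else Status.failed) ≠ .active := by
        cases b <;> simp
      have he : s.Evolves { s with
          status := Function.update s.status d (if b then .successful else .failed) } := by
        refine ⟨fun e h => ?_, fun e a _ h => h⟩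
        rcases eq_or_ne e d with rfl | hed
        · exact hd
        · simpa [Function.update_of_ne hed] using h
      exact ⟨he, ⟨hs.mem_used, hs.address_eq, fun a p h => (hs.ownsBelow a p h).evolves he⟩,
        by simpa [Frame.Valid, MCASPC.Valid] using hne, rfl,
        .inl ⟨d, hu d rfl, hd, by simpa using hne⟩⟩
    · next hd =>
      exact ⟨.refl s, hs, hd, rfl, .inr ⟨rfl, .inr ⟨rfl, rfl, by simp [Frame.rank]⟩⟩⟩
  | .mcas d .ret, _, _ => cases h

theorem frameStep_call {s s' : Shared desc} {f f' : Frame desc} {e : D}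
    (h : frameStep s f = (s', .call f' e)) (hf : f.Valid s) :
    s' = s ∧ f'.Valid s ∧ f'.target = f.target ∧ f'.WaitsFor s e ∧ s.status e = .active ∧
      ∃ a, s.Owns e a := by
  match f, hf with
  | .read addr pc, hf =>
    simp only [frameStep] at h
    split at h <;> cases h
    next hr =>
    obtain ⟨_, h₂, h₃⟩ := readInternalStep_help hr hf
    exact ⟨rfl, trivial, rfl, trivial, h₂, addr, h₃⟩
  | .mcas d (.reading i pc), hf =>
    simp only [frameStep, mcasStep] at h
    split at h
    · cases h
    · next hr =>
      cases h
      obtain ⟨h₁, h₂, h₃⟩ := readInternalStep_help hr hf.2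
      exact ⟨rfl, ⟨hf.1, trivial⟩, rfl, ⟨fun h => h₁ (congrArg some h), fun _ => h₃⟩, h₂, _, h₃⟩
    · split at h
      · cases h
      · split at h <;> cases h
  | .mcas d (.statusCheck i c), _ =>
    simp only [frameStep, mcasStep] at h
    split at h <;> cases h
  | .mcas d (.acquire i c), _ =>
    simp only [frameStep, mcasStep] at h
    split at h <;> cases h
  | .mcas d (.finalize b), _ =>
    simp only [frameStep, mcasStep] at h
    split at h <;> cases h
  | .mcas d .ret, _ => cases h

theorem frameStep_ret {s s' : Shared desc} {f : Frame desc} {r : Result Val}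
    (h : frameStep s f = (s', .ret r)) (hf : f.Valid s) :
    s' = s ∧ ∀ d, f.target = some d → s.status d ≠ .active := by
  match f, hf with
  | .read addr pc, _ =>
    simp only [frameStep] at h
    split at h <;> cases h
    exact ⟨rfl, fun d hd => (nomatch hd)⟩
  | .mcas d (.reading i pc), _ =>
    simp only [frameStep, mcasStep] at h
    split at h
    · cases h
    · cases h
    · split at h
      · cases h
      · split at h <;> cases h
  | .mcas d (.statusCheck i c), _ =>
    simp only [frameStep, mcasStep] at h
    split at h <;> cases h
  | .mcas d (.acquire i c), _ =>
    simp only [frameStep, mcasStep] at h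
    split at h <;> cases h
  | .mcas d (.finalize b), _ =>
    simp only [frameStep, mcasStep] at h
    split at h <;> cases h
  | .mcas d .ret, hf =>
    cases h
    exact ⟨rfl, fun e he => by cases he; exact hf⟩

end Steps

/-! ### Invariants of configurations -/

/-- Invariant of a call stack. -/
structure StackValid (s : Shared desc) (used : Set D) (l : List (Frame desc)) : Prop where
  frame : ∀ f ∈ l, f.Valid s
  target : ∀ f ∈ l, ∀ d, f.target = some d → d ∈ used
  chain : l.IsChain (Frame.CalledBy s)

theorem StackValid.evolves {s s' : Shared desc} {used used' : Set D} {l : List (Frame desc)}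
    (h : StackValid s used l) (hs : s.Evolves s') (hu : used ⊆ used') : StackValid s' used' l :=
  ⟨fun f hf => (h.frame f hf).evolves hs, fun f hf d hd => hu (h.target f hf d hd),
    h.chain.imp fun _ _ h => h.evolves hs⟩

theorem StackValid.tail {s : Shared desc} {used : Set D} {f : Frame desc} {l : List (Frame desc)}
    (h : StackValid s used (f :: l)) : StackValid s used l :=
  ⟨fun g hg => h.frame g (.tail _ hg), fun g hg => h.target g (.tail _ hg), h.chain.tail⟩

theorem StackValid.replace {s : Shared desc} {used : Set D} {f f' : Frame desc}
    {l : List (Frame desc)} (h : StackValid s used (f :: l)) (hf : f'.Valid s)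
    (ht : f'.target = f.target) : StackValid s used (f' :: l) := by
  refine ⟨?_, ?_, ?_⟩
  · simpa [hf] using h.tail.frame
  · simpa [ht] using h.target
  · have := h.chain
    cases l with
    | nil => simp
    | cons g l =>
      rw [List.isChain_cons_cons] at this ⊢
      exact ⟨this.1.congr_left ht, this.2⟩

theorem StackValid.push {s : Shared desc} {used : Set D} {g : Frame desc}
    {l : List (Frame desc)} (h : StackValid s used (g :: l)) {e : D} (he : e ∈ used)
    (hg : g.WaitsFor s e) : StackValid s used (.mcas e (nextWord e 0) :: g :: l) := by
  refine ⟨?_, ?_, ?_⟩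
  · rintro f (_ | ⟨_, hf⟩)
    · exact valid_nextWord (.zero s e)
    · exact h.frame f hf
  · rintro f (_ | ⟨_, hf⟩) d hd
    · cases hd
      exact he
    · exact h.target f hf d hd
  · exact List.isChain_cons_cons.2 ⟨⟨e, rfl, hg⟩, h.chain⟩

/-- Invariant of configurations. -/
structure Config.Valid {n : ℕ} (c : Config desc n) : Prop where
  finite_used : c.used.Finite
  shared : c.shared.Valid c.used
  stack : ∀ T, StackValid c.shared c.used (c.stack T)

theorem Config.IsInitial.valid {n : ℕ} {c : Config desc n} (h : c.IsInitial) : c.Valid := by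
  obtain ⟨h₁, -, h₃, h₄⟩ := h
  have hp : ∀ a p, c.shared.mem a ≠ .ptr p := by
    intro a p
    obtain ⟨v, hv⟩ := h₁ a
    rw [hv]
    nofun
  refine ⟨h₄ ▸ Set.finite_empty, ⟨fun a p h => absurd h (hp a p), fun a p h => absurd h (hp a p),
    fun a p h => absurd h (hp a p)⟩, fun T => ?_⟩
  rw [h₃ T]
  exact ⟨by simp, by simp, by simp⟩

/-- The stacks after a step of one thread are valid if its own stack is. -/
theorem stackValid_update {n : ℕ} {stack : Fin n → List (Frame desc)} {s s' : Shared desc}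
    {used used' : Set D} (h : ∀ T, StackValid s used (stack T)) (hs : s.Evolves s')
    (hu : used ⊆ used') (T : Fin n) {l : List (Frame desc)} (hl : StackValid s' used' l)
    (T' : Fin n) : StackValid s' used' (Function.update stack T l T') := by
  rcases eq_or_ne T' T with rfl | hT
  · rwa [Function.update_self]
  · rw [Function.update_of_ne hT]
    exact (h T').evolves hs hu

theorem Step.valid [DecidableEq D] [DecidableEq Val] {n : ℕ} {c c' : Config desc n} {T : Fin n}
    {e : Event Addr Val D} (h : Step c T e c') (hc : c.Valid) : c'.Valid := by
  obtain ⟨hfin, hsh, hst⟩ := hc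
  cases h with
  | invokeRead addr hT =>
    exact ⟨hfin, hsh, stackValid_update hst (.refl _) subset_rfl T
      ⟨by simp [Frame.Valid, ReadPC.Valid], by simp [Frame.target], by simp⟩⟩
  | invokeMCAS d hT hd =>
    refine ⟨hfin.insert d, ⟨fun a p h => .inr (hsh.mem_used a p h), hsh.address_eq, hsh.ownsBelow⟩,
      stackValid_update hst (.refl _) (Set.subset_insert d _) T ⟨?_, ?_, by simp⟩⟩
    · simpa [Frame.Valid] using valid_nextWord (.zero c.shared d)
    · simp [Frame.target]
  | goto f f' fs s' hT hf =>
    have hl := hT ▸ hst T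
    have H := frameStep_goto hf hsh (hl.frame f (by simp)) (hl.target f (by simp))
    exact ⟨hfin, H.shared, stackValid_update hst H.evolves subset_rfl T
      ((hl.evolves H.evolves subset_rfl).replace H.frame H.target)⟩
  | call f f' fs s' d hT hf =>
    have hl := hT ▸ hst T
    obtain ⟨rfl, hv, ht, hw, -, a, i, ha⟩ := frameStep_call hf (hl.frame f (by simp))
    exact ⟨hfin, hsh, stackValid_update hst (.refl _) subset_rfl T
      ((hl.replace hv ht).push (hsh.mem_used a _ ha) hw)⟩
  | innerReturn f g fs s' r hT hf =>
    have hl := hT ▸ hst T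
    obtain ⟨rfl, -⟩ := frameStep_ret hf (hl.frame f (by simp))
    exact ⟨hfin, hsh, stackValid_update hst (.refl _) subset_rfl T hl.tail⟩
  | response f s' r hT hf =>
    have hl := hT ▸ hst T
    obtain ⟨rfl, -⟩ := frameStep_ret hf (hl.frame f (by simp))
    exact ⟨hfin, hsh, stackValid_update hst (.refl _) subset_rfl T hl.tail⟩

/-! ### Chains of active calls -/

/-- The call works for an active descriptor. -/
def Frame.IsActive (s : Shared desc) (f : Frame desc) : Prop :=
  ∃ d, f.target = some d ∧ s.status d = .active

open Classical in
/-- The number of consecutive topmost calls of a stack that work for active descriptors. -/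
noncomputable def activeDepth (s : Shared desc) (l : List (Frame desc)) : ℕ :=
  (l.takeWhile fun f => f.IsActive s).length

theorem Frame.isActive_congr {s s' : Shared desc} (hs : s'.status = s.status)
    {f f' : Frame desc} (hf : f'.target = f.target) : f'.IsActive s' ↔ f.IsActive s := by
  rw [Frame.IsActive, Frame.IsActive, hs, hf]

theorem activeDepth_congr {s s' : Shared desc} (hs : s'.status = s.status)
    (l : List (Frame desc)) : activeDepth s' l = activeDepth s l := by
  have h : Frame.IsActive s' = Frame.IsActive s :=
    funext fun _ => propext (Frame.isActive_congr hs rfl)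
  rw [activeDepth, h, activeDepth]

theorem activeDepth_cons_of_active {s : Shared desc} {f : Frame desc} (hf : f.IsActive s)
    (l : List (Frame desc)) : activeDepth s (f :: l) = activeDepth s l + 1 := by
  simp [activeDepth, hf]

theorem activeDepth_cons_of_not_active {s : Shared desc} {f : Frame desc} (hf : ¬f.IsActive s)
    (l : List (Frame desc)) : activeDepth s (f :: l) = 0 := by
  simp [activeDepth, hf]

theorem activeDepth_replace {s : Shared desc} {f f' : Frame desc} (hf : f'.target = f.target)
    (l : List (Frame desc)) : activeDepth s (f' :: l) = activeDepth s (f :: l) := by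
  have h := Frame.isActive_congr (rfl : s.status = s.status) hf
  by_cases hs : f.IsActive s
  · rw [activeDepth_cons_of_active hs, activeDepth_cons_of_active (h.2 hs)]
  · rw [activeDepth_cons_of_not_active hs, activeDepth_cons_of_not_active (mt h.1 hs)]

/-- Relation between a call `f` of `MCAS(e)` and a call `g` below it in a chain of active calls:
`g` works on a word whose address is not owned by its own descriptor and is at most as large as an
address owned by `e`. Unlike `Frame.CalledBy`, this relation is transitive. -/
def Frame.Above (s : Shared desc) (f g : Frame desc) : Prop :=
  ∃ e d i pc, f.target = some e ∧ g = .mcas d (.reading i pc) ∧ s.status d = .active ∧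
    (∃ b, ((desc d).words i).address ≤ b ∧ s.Owns e b) ∧ ¬s.Owns d ((desc d).words i).address

theorem Frame.CalledBy.above {s : Shared desc} {f g : Frame desc} (h : f.CalledBy s g)
    (hf : f.IsActive s) (hg : g.IsActive s) : f.Above s g := by
  obtain ⟨e, hfe, hw⟩ := h
  obtain ⟨e', hfe', he⟩ := hf
  obtain rfl : e = e' := Option.some_injective _ (hfe.symm.trans hfe')
  obtain ⟨d, hgd, hd⟩ := hg
  match g, hw, hgd with
  | .mcas d' (.reading i .load), hw, hgd =>
    cases hgd
    exact ⟨e, d, i, _, hfe, rfl, hd, ⟨_, le_rfl, hw.2 he⟩, fun h => hw.1 ((hw.2 he).unique h)⟩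

theorem Frame.Above.trans {s : Shared desc} {used : Set D} (hs : s.Valid used)
    {f g h : Frame desc} (hfg : f.Above s g) (hgh : g.Above s h) : f.Above s h := by
  obtain ⟨e, d, i, pc, hf, rfl, hd, ⟨b, hib, hb⟩, hn⟩ := hfg
  obtain ⟨e', d', i', pc', hg, rfl, hd', ⟨b', hib', hb'⟩, hn'⟩ := hgh
  cases hg
  -- As `d` owns `b'` but not the address it waits at, the latter is the larger one.
  have hlt : b' < ((desc d).words i).address :=
    lt_of_not_ge fun hle => hn (hs.owns_of_le hd hb' i hle)
  exact ⟨e, d', i', pc', hf, rfl, hd', ⟨b, hib'.trans (hlt.le.trans hib), hb⟩, hn'⟩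

theorem Frame.Above.target_ne {s : Shared desc} {used : Set D} (hs : s.Valid used)
    {f g : Frame desc} (h : f.Above s g) : f.target ≠ g.target := by
  obtain ⟨e, d, i, pc, hf, rfl, hd, ⟨b, hib, hb⟩, hn⟩ := h
  intro heq
  cases hf.symm.trans heq
  exact hn (hs.owns_of_le hd hb i hib)

/-- In a chain of active calls no descriptor occurs twice. -/
theorem activeDepth_le {s : Shared desc} {used : Set D} (hs : s.Valid used) (hfin : used.Finite)
    {l : List (Frame desc)} (hl : StackValid s used l) : activeDepth s l ≤ used.ncard := by
  classical
  set m := l.takeWhile fun f => f.IsActive s with hm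
  have hact : ∀ f ∈ m, f.IsActive s := fun f hf => by
    simpa using List.mem_takeWhile_imp hf
  have hpre : m <+: l := List.takeWhile_prefix _
  have habove : m.IsChain (Frame.Above s) :=
    (hl.chain.prefix hpre).imp_of_mem_imp fun f g hf hg h => h.above (hact f hf) (hact g hg)
  have : IsTrans _ (Frame.Above s) := ⟨fun _ _ _ => Frame.Above.trans hs⟩
  have hnodup : (m.map Frame.target).Nodup :=
    List.pairwise_map.2 (habove.pairwise.imp fun h => h.target_ne hs)
  have hsub : (m.map Frame.target).toFinset ⊆ hfin.toFinset.image some := by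
    intro o ho
    obtain ⟨f, hf, rfl⟩ := List.mem_map.1 (List.mem_toFinset.1 ho)
    obtain ⟨d, hd, -⟩ := hact f hf
    rw [hd]
    exact Finset.mem_image_of_mem _ (hfin.mem_toFinset.2 (hl.target f (hpre.subset hf) d hd))
  calc m.length = (m.map Frame.target).toFinset.card := by
        rw [List.toFinset_card_of_nodup hnodup, List.length_map]
    _ ≤ (hfin.toFinset.image some).card := Finset.card_le_card hsub
    _ = used.ncard := by
        rw [Finset.card_image_of_injective _ (Option.some_injective _),
          Set.ncard_eq_toFinset_card used hfin]

/-! ### The progress measure -/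

/-- The sum of a measure of stacks over all threads. -/
def Config.total {n : ℕ} (c : Config desc n) (g : List (Frame desc) → ℕ) : ℕ :=
  ∑ T, g (c.stack T)

theorem Config.total_add {n : ℕ} {c c' : Config desc n} {T : Fin n} {l : List (Frame desc)}
    (h : c'.stack = Function.update c.stack T l) (g : List (Frame desc) → ℕ) :
    c'.total g + g (c.stack T) = c.total g + g l := by
  simp only [Config.total, h]
  rw [← Finset.add_sum_erase _ _ (Finset.mem_univ T),
    ← Finset.add_sum_erase _ (fun T => g (c.stack T)) (Finset.mem_univ T), Function.update_self,
    Finset.sum_congr rfl fun T' hT' => by rw [Function.update_of_ne (Finset.ne_of_mem_erase hT')]]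
  omega

/-- A measure of configurations that decreases with every step other than a response. -/
noncomputable def Config.progress {n : ℕ} (c : Config desc n) : ℕ ×ₗ ℕ ×ₗ ℕ ×ₗ ℕ ×ₗ ℕ ×ₗ ℕ :=
  toLex (c.total fun l => l.isEmpty.toNat,
    toLex ({d ∈ c.used | c.shared.status d = .active}.ncard,
      toLex (c.total fun l => c.used.ncard - activeDepth c.shared l,
        toLex (c.total List.length,
          toLex (c.total fun l => (l.map Frame.remaining).sum,
            c.total fun l => (l.map (Frame.rank c.shared)).sum)))))

theorem Step.progress_lt [DecidableEq D] [DecidableEq Val] {n : ℕ} {c c' : Config desc n}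
    {T : Fin n} {e : Event Addr Val D} (h : Step c T e c') (hc : c.Valid)
    (he : ∀ r, e ≠ .response r) : c'.progress < c.progress := by
  have hc' := h.valid hc
  obtain ⟨hfin, hsh, hst⟩ := hc
  simp only [Config.progress, Prod.Lex.toLex_lt_toLex]
  cases h with
  | invokeRead addr hT =>
    left
    have h₁ := Config.total_add (c := c)
      (c' := { c with stack := Function.update c.stack T [.read addr .load] })
      (T := T) (l := [.read addr .load]) rfl fun l => l.isEmpty.toNat
    simp only [hT, List.isEmpty_nil, List.isEmpty_cons, Bool.toNat_true, Bool.toNat_false] at h₁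
    exact Nat.lt_of_succ_le h₁.le
  | invokeMCAS d hT hd =>
    left
    have h₁ := Config.total_add (c := c)
      (c' := { c with
        stack := Function.update c.stack T [.mcas d (nextWord d 0)], used := insert d c.used })
      (T := T) (l := [.mcas d (nextWord d 0)]) rfl fun l => l.isEmpty.toNat
    simp only [hT, List.isEmpty_nil, List.isEmpty_cons, Bool.toNat_true, Bool.toNat_false] at h₁
    exact Nat.lt_of_succ_le h₁.le
  | goto f f' fs s' hT hf =>
    have hl := hT ▸ hst T
    have H := frameStep_goto hf hsh (hl.frame f (by simp)) (hl.target f (by simp))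
    have add := Config.total_add (c := c)
      (c' := { c with shared := s', stack := Function.update c.stack T (f' :: fs) })
      (T := T) (l := f' :: fs) rfl
    have h₁ := add fun l => l.isEmpty.toNat
    rw [hT] at add h₁
    refine .inr ⟨by simpa using h₁, ?_⟩
    rcases H.progress with ⟨d, hd, hda, hdn⟩ | ⟨hstatus, hprog⟩
    · refine .inl (Set.ncard_lt_ncard ?_ (hfin.subset (Set.sep_subset _ _)))
      refine Set.ssubset_iff_exists.2 ⟨fun x hx => ⟨hx.1, H.evolves.active x hx.2⟩,
        d, ⟨hd, hda⟩, fun h => hdn h.2⟩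
    · refine .inr ⟨by simp only [hstatus], .inr ⟨?_, .inr ⟨?_, ?_⟩⟩⟩
      · have h₃ := add fun l => c.used.ncard - activeDepth c.shared l
        rw [activeDepth_replace H.target] at h₃
        simpa only [activeDepth_congr hstatus] using Nat.add_right_cancel h₃
      · simpa using add List.length
      · have h₅ := add fun l => (l.map Frame.remaining).sum
        simp only [List.map_cons, List.sum_cons] at h₅
        rcases hprog with hlt | ⟨rfl, heq, hlt⟩
        · left
          omega
        · right
          have h₆ := add fun l => (l.map (Frame.rank c.shared)).sum
          simp only [List.map_cons, List.sum_cons] at h₆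
          dsimp only
          constructor <;> omega
  | call f f' fs s' d hT hf =>
    have hl := hT ▸ hst T
    obtain ⟨rfl, hv, ht, hw, hd, -⟩ := frameStep_call hf (hl.frame f (by simp))
    have hle := activeDepth_le hc'.shared hc'.finite_used (hc'.stack T)
    have add := Config.total_add (c := c)
      (c' := { c with
        stack := Function.update c.stack T (.mcas d (nextWord d 0) :: f' :: fs) })
      (T := T) (l := .mcas d (nextWord d 0) :: f' :: fs) rfl
    have h₁ := add fun l => l.isEmpty.toNat
    rw [hT] at add h₁
    refine .inr ⟨by simpa using h₁, .inr ⟨rfl, .inl ?_⟩⟩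
    have h₃ := add fun l => c.used.ncard - activeDepth c.shared l
    simp only [Function.update_self] at hle
    have hact : (Frame.mcas d (nextWord d 0)).IsActive c.shared := ⟨d, rfl, hd⟩
    rw [activeDepth_cons_of_active hact, activeDepth_replace ht] at h₃ hle
    dsimp only at h₃ hle ⊢
    omega
  | innerReturn f g fs s' r hT hf =>
    have hl := hT ▸ hst T
    obtain ⟨rfl, hd⟩ := frameStep_ret hf (hl.frame f (by simp))
    have add := Config.total_add (c := c)
      (c' := { c with stack := Function.update c.stack T (g :: fs) })
      (T := T) (l := g :: fs) rfl
    have h₁ := add fun l => l.isEmpty.toNat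
    rw [hT] at add h₁
    refine .inr ⟨by simpa using h₁, .inr ⟨rfl, ?_⟩⟩
    have h₃ := add fun l => c.used.ncard - activeDepth c.shared l
    have h₄ := add List.length
    have hact : ¬f.IsActive c.shared := fun ⟨d, hfd, hda⟩ => hd d hfd hda
    rw [activeDepth_cons_of_not_active hact] at h₃
    simp only [List.length_cons] at h₄
    -- The returning call is not active, so the active depth was zero before.
    dsimp only at h₃ ⊢
    omega
  | response f s' r hT hf => exact absurd rfl (he r)

theorem Execution.valid [DecidableEq D] [DecidableEq Val] {n : ℕ} (E : Execution desc n) (t : ℕ) :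
    (E.config t).Valid := by
  induction t with
  | zero => exact E.initial.valid
  | succ t ih => exact (E.step t).valid ih

end Proof

end MCAS

theorem mainTheorem2 {Addr Val D : Type*} [LinearOrder Addr] [DecidableEq D] [DecidableEq Val]
    (desc : D → MCAS.MCASDescriptor Addr Val) (n : ℕ) : MCAS.LockFree desc n := by
  intro E _ t₀
  by_contra! h
  have hanti : StrictAnti fun k => (E.config (t₀ + k)).progress :=
    strictAnti_nat_of_succ_lt fun k =>
      (E.step (t₀ + k)).progress_lt (E.valid _) (h _ (Nat.le_add_right _ _))
  exact not_strictAnti_of_wellFoundedLT _ hanti
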